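/- Let $n\ge 1$ and let $\mathcal H_n=\{w=(z,t): z\in\mathbb C^n,\ t\in\mathbb R\}$ be the Heisenberg group, with product $(z,t)(z',t')=(z+z',\,t+t'+2\,\mathrm{Im}\, z\cdot\bar z')$, where $z\cdot\bar z'=\sum_k z_k\bar z'_k$, with Haar measure $dw=4^n\,dx\,dy\,dt$ ($z=x+iy$), and with $|w|=(|z|^4+t^2)^{1/4}$, where $|z|$ is the Euclidean norm. All $L^p$ norms are taken with respect to $dw$, and $*$ is convolution on the group, $(k*g)(w)=\int_{\mathcal H_n} k(v)\,g(v^{-1}w)\,dv$. Let $1<p<\infty$, $1/p+1/p'=1$, $0<\lambda<2n+2$, $\alpha<2n/p$, $\beta<2n/p'$ and $2n+2=\lambda+\alpha+\beta$. Then for every $f\in L^p(\mathcal H_n)$ the integral defining $|w|^{-\lambda}*(|z|^{-\beta}f)$ converges absolutely almost everywhere, the function $|z|^{-\alpha}\big(|w|^{-\lambda}*(|z|^{-\beta}f)\big)$ belongs to $L^p(\mathcal H_n)$, and $$\Big\|\,|z|^{-\alpha}\Big(|w|^{-\lambda}*\big(|z|^{-\beta}f\big)\Big)\Big\|_{L^p(\mathcal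 H_n)}\le D_{\alpha,\beta}\,\|f\|_{L^p(\mathcal H_n)},$$ $$D_{\alpha,\beta}=(4\pi^2)^n\sqrt{\pi}\left[\frac{\Gamma\big(\frac{2n-\alpha-\beta}{4}\big)\,\Gamma\big(\frac{\alpha+\beta}{2}\big)\,\Gamma\big(\frac np-\frac\alpha2\big)\,\Gamma\big(\frac n{p'}-\frac\beta2\big)}{\Gamma\big(\frac{2n+2-\alpha-\beta}{4}\big)\,\Gamma\big(\frac{2n-\alpha-\beta}{2}\big)\,\Gamma\big(\frac n{p'}+\frac\alpha2\big)\,\Gamma\big(\frac np+\frac\beta2\big)}\right].$$ -/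

import Mathlib

open MeasureTheory
open scoped ENNReal

/-- The Heisenberg group `H_n`, with underlying space `ℂⁿ × ℝ`. A point is `w = (z, t)`. -/
def Heisenberg (n : ℕ) : Type := EuclideanSpace ℂ (Fin n) × ℝ

namespace Heisenberg

/-- The component `z ∈ ℂⁿ` of `w = (z, t)`; its norm `‖w.z‖` is the Euclidean one. -/
def z {n : ℕ} (w : Heisenberg n) : EuclideanSpace ℂ (Fin n) := w.1

/-- The component `t ∈ ℝ` of `w = (z, t)`. -/
def t {n : ℕ} (w : Heisenberg n) : ℝ := w.2

/-- The point `(z, t)`. -/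
def mk {n : ℕ} (z : EuclideanSpace ℂ (Fin n)) (t : ℝ) : Heisenberg n := (z, t)

@[ext] theorem ext {n : ℕ} {v w : Heisenberg n} (hz : v.z = w.z) (ht : v.t = w.t) : v = w :=
  Prod.ext hz ht

/-- The product topology of `ℂⁿ × ℝ`. -/
noncomputable instance (n : ℕ) : TopologicalSpace (Heisenberg n) :=
  inferInstanceAs (TopologicalSpace (EuclideanSpace ℂ (Fin n) × ℝ))

/-- The product (equivalently, Borel) measurable structure of `ℂⁿ × ℝ`. -/
noncomputable instance (n : ℕ) : MeasurableSpace (Heisenberg n) :=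
  inferInstanceAs (MeasurableSpace (EuclideanSpace ℂ (Fin n) × ℝ))

instance (n : ℕ) : BorelSpace (Heisenberg n) :=
  inferInstanceAs (BorelSpace (EuclideanSpace ℂ (Fin n) × ℝ))

/-- The group law `(z, t) (z', t') = (z + z', t + t' + 2 Im (z · conj z'))`. -/
instance (n : ℕ) : Mul (Heisenberg n) where
  mul v w := mk (v.z + w.z) (v.t + w.t + 2 * (∑ k, v.z k * starRingEnd ℂ (w.z k)).im)

instance (n : ℕ) : One (Heisenberg n) where
  one := mk 0 0

instance (n : ℕ) : Inv (Heisenberg n) where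
  inv w := mk (-w.z) (-w.t)

@[simp] theorem mul_z {n : ℕ} (v w : Heisenberg n) : (v * w).z = v.z + w.z := rfl

@[simp] theorem mul_t {n : ℕ} (v w : Heisenberg n) :
    (v * w).t = v.t + w.t + 2 * (∑ k, v.z k * starRingEnd ℂ (w.z k)).im := rfl

@[simp] theorem one_z {n : ℕ} : (1 : Heisenberg n).z = 0 := rfl

@[simp] theorem one_t {n : ℕ} : (1 : Heisenberg n).t = 0 := rfl

@[simp] theorem inv_z {n : ℕ} (w : Heisenberg n) : (w⁻¹).z = -w.z := rfl

@[simp] theorem inv_t {n : ℕ} (w : Heisenberg n) : (w⁻¹).t = -w.t := rfl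

instance (n : ℕ) : Group (Heisenberg n) :=
  Group.ofLeftAxioms
    (by
      intro a b c
      ext1
      · simp [add_assoc]
      · simp [add_mul, mul_add, Finset.sum_add_distrib]
        ring)
    (by
      intro a
      ext1 <;> simp)
    (by
      intro a
      ext1
      · simp
      · simp [Complex.mul_conj, ← Complex.ofReal_sum])

/-- The Haar measure `dw = dz dz̄ dt = 4ⁿ dx dy dt`, where `z = x + i y` and `dx dy` is Lebesgue
measure on `ℂⁿ = ℝ²ⁿ`. -/
noncomputable def haar (n : ℕ) : Measure (Heisenberg n) :=
  (4 : ℝ≥0∞) ^ n • (volume : Measure (EuclideanSpace ℂ (Fin n) × ℝ))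

/-- The homogeneous norm `|w| = (|z|⁴ + t²)^{1/4}`. -/
noncomputable def gauge {n : ℕ} (w : Heisenberg n) : ℝ :=
  (‖w.z‖ ^ 4 + w.t ^ 2) ^ (1 / 4 : ℝ)

/-- Convolution on the group, `(k * g)(w) = ∫ k(v) g(v⁻¹ w) dv`. -/
noncomputable def conv {n : ℕ} (k : Heisenberg n → ℝ) (g : Heisenberg n → ℂ)
    (w : Heisenberg n) : ℂ :=
  ∫ v, k v • g (v⁻¹ * w) ∂(haar n)

/-- The integral that defines `(k * g)(w)` converges absolutely. -/
def ConvExistsAt {n : ℕ} (k : Heisenberg n → ℝ) (g : Heisenberg n → ℂ)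
    (w : Heisenberg n) : Prop :=
  Integrable (fun v => k v • g (v⁻¹ * w)) (haar n)

/-- The kernel `|w|^{-lam}`. -/
noncomputable def kernel (n : ℕ) (lam : ℝ) (w : Heisenberg n) : ℝ :=
  w.gauge ^ (-lam)

/-- Multiplication by the weight: `w = (z, t) ↦ |z|^{-a} g(w)`. -/
noncomputable def weighted {n : ℕ} (a : ℝ) (g : Heisenberg n → ℂ) (w : Heisenberg n) : ℂ :=
  ‖w.z‖ ^ (-a) • g w

/-- The Stein–Weiss operator `f ↦ |z|^{-α} (|w|^{-lam} * (|z|^{-β} f))`. -/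
noncomputable def steinWeiss {n : ℕ} (lam α β : ℝ) (f : Heisenberg n → ℂ) :
    Heisenberg n → ℂ :=
  weighted α (conv (kernel n lam) (weighted β f))

/-- The constant `D_{α,β}`; `q` is the exponent dual to `p`. -/
noncomputable def steinWeissConst (n : ℕ) (p q α β : ℝ) : ℝ :=
  (4 * Real.pi ^ 2) ^ n * √Real.pi *
    ((Real.Gamma ((2 * n - α - β) / 4) * Real.Gamma ((α + β) / 2) *
        Real.Gamma (n / p - α / 2) * Real.Gamma (n / q - β / 2)) /
      (Real.Gamma ((2 * n + 2 - α - β) / 4) * Real.Gamma ((2 * n - α - β) / 2) *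
        Real.Gamma (n / q + α / 2) * Real.Gamma (n / p + β / 2)))

end Heisenberg

/-!
The integral kernel `|z|^{-α} |w u⁻¹|^{-lam} |z'|^{-β}` of the operator is nonnegative, so Schur's
test applies, here with the weight `h = |z|^{-2n/(pq)}`. Integrating `|w u⁻¹|^{-lam}` over the
centre leaves a multiple of `|z - z'|^{-(lam - 2)}`, and both Schur conditions become compositions
of Riesz kernels on `ℂⁿ`, evaluated by writing each power as a superposition of Gaussians.

In terms of `a = (α + β)/2`, `b = n/q - β/2` and `c = n/p - α/2`, which are positive with sum `n`,
the two conditions are exchanged by `b ↔ c`, which leaves the constant unchanged. The constant that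
comes out is `D_{α,β} / πⁿ`.
-/

section Integrals

open Real Set

variable {X : Type*} [MeasurableSpace X] {μ : Measure X}

theorem lintegral_Ioi_rpow_mul_exp_neg {u c : ℝ} (hu : 0 < u) (hc : 0 < c) :
    ∫⁻ r in Ioi (0 : ℝ), ENNReal.ofReal (r ^ (u - 1) * exp (-(c * r))) =
      ENNReal.ofReal (Gamma u * c ^ (-u)) := by
  have hint : IntegrableOn (fun r : ℝ => r ^ (u - 1) * exp (-(c * r))) (Ioi 0) := by
    simpa using integrableOn_rpow_mul_exp_neg_mul_rpow (p := 1) (s := u - 1) (by linarith)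
      one_pos hc
  have hnonneg : ∀ᵐ r ∂volume.restrict (Ioi (0 : ℝ)), 0 ≤ r ^ (u - 1) * exp (-(c * r)) := by
    filter_upwards [ae_restrict_mem measurableSet_Ioi] with r (hr : 0 < r)
    positivity
  rw [← ofReal_integral_eq_lintegral_ofReal hint hnonneg,
    integral_rpow_mul_exp_neg_mul_Ioi hu hc, one_div, inv_rpow hc.le, ← rpow_neg hc.le, mul_comm]

theorem ofReal_Gamma_mul_lintegral_mul_rpow_neg [SFinite μ] {u : ℝ} (hu : 0 < u) {g : X → ℝ≥0∞}
    (hg : AEMeasurable g μ) {F : X → ℝ} (hF : AEMeasurable F μ) (hF_pos : ∀ᵐ x ∂μ, 0 < F x) :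
    ENNReal.ofReal (Gamma u) * ∫⁻ x, g x * ENNReal.ofReal (F x ^ (-u)) ∂μ =
      ∫⁻ r in Ioi (0 : ℝ), ENNReal.ofReal (r ^ (u - 1)) *
        ∫⁻ x, g x * ENNReal.ofReal (exp (-(F x * r))) ∂μ := by
  calc
    _ = ∫⁻ x, (∫⁻ r in Ioi (0 : ℝ), g x * ENNReal.ofReal (r ^ (u - 1) * exp (-(F x * r)))) ∂μ := by
      rw [← lintegral_const_mul' _ _ ENNReal.ofReal_ne_top]
      refine lintegral_congr_ae ?_
      filter_upwards [hF_pos] with x hx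
      rw [lintegral_const_mul _ (by fun_prop), lintegral_Ioi_rpow_mul_exp_neg hu hx,
        ENNReal.ofReal_mul (Gamma_pos_of_pos hu).le, mul_left_comm]
    _ = ∫⁻ r in Ioi (0 : ℝ), ∫⁻ x, g x * ENNReal.ofReal (r ^ (u - 1) * exp (-(F x * r))) ∂μ :=
      lintegral_lintegral_swap (by fun_prop)
    _ = _ := by
      refine setLIntegral_congr_fun measurableSet_Ioi fun r (hr : 0 < r) => ?_
      rw [← lintegral_const_mul' _ _ ENNReal.ofReal_ne_top]
      refine lintegral_congr fun x => ?_
      rw [ENNReal.ofReal_mul (by positivity), mul_left_comm]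

theorem ofReal_Gamma_mul_Gamma_mul_lintegral_rpow_neg_mul_rpow_neg [SFinite μ] {u v : ℝ}
    (hu : 0 < u) (hv : 0 < v) {F G : X → ℝ} (hF : AEMeasurable F μ) (hG : AEMeasurable G μ)
    (hF_pos : ∀ᵐ x ∂μ, 0 < F x) (hG_pos : ∀ᵐ x ∂μ, 0 < G x) :
    ENNReal.ofReal (Gamma u * Gamma v) *
        ∫⁻ x, ENNReal.ofReal (F x ^ (-u)) * ENNReal.ofReal (G x ^ (-v)) ∂μ =
      ∫⁻ t in Ioi (0 : ℝ), ENNReal.ofReal (t ^ (v - 1)) *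
        ∫⁻ s in Ioi (0 : ℝ), ENNReal.ofReal (s ^ (u - 1)) *
          ∫⁻ x, ENNReal.ofReal (exp (-(F x * s))) * ENNReal.ofReal (exp (-(G x * t))) ∂μ := by
  rw [ENNReal.ofReal_mul (Gamma_pos_of_pos hu).le, mul_assoc,
    ofReal_Gamma_mul_lintegral_mul_rpow_neg hv (by fun_prop) hG hG_pos,
    ← lintegral_const_mul' _ _ ENNReal.ofReal_ne_top]
  refine lintegral_congr fun t => ?_
  simp only [mul_comm _ (ENNReal.ofReal (exp (-(G _ * t))))]
  rw [mul_left_comm, ofReal_Gamma_mul_lintegral_mul_rpow_neg hu (by fun_prop) hF hF_pos]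

theorem lintegral_Ioi_rpow_mul_one_add_rpow_neg {u v : ℝ} (hu : 0 < u) (hv : 0 < v) :
    ∫⁻ r in Ioi (0 : ℝ), ENNReal.ofReal (r ^ (u - 1)) * ENNReal.ofReal ((1 + r) ^ (-(u + v))) =
      ENNReal.ofReal (Gamma u * Gamma v / Gamma (u + v)) := by
  have hΓ : 0 < Gamma (u + v) := Gamma_pos_of_pos (by positivity)
  rw [ENNReal.ofReal_div_of_pos hΓ,
    ENNReal.eq_div_iff (by simpa using hΓ) ENNReal.ofReal_ne_top,
    ofReal_Gamma_mul_lintegral_mul_rpow_neg (by positivity) (by fun_prop) (by fun_prop)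
      (by filter_upwards [ae_restrict_mem measurableSet_Ioi] with r (hr : 0 < r); positivity)]
  calc
    _ = ∫⁻ s in Ioi (0 : ℝ),
        ENNReal.ofReal (Gamma u) * ENNReal.ofReal (s ^ (v - 1) * exp (-(1 * s))) := by
      refine setLIntegral_congr_fun measurableSet_Ioi fun s (hs : 0 < s) => ?_
      have hinner : ∫⁻ r in Ioi (0 : ℝ), ENNReal.ofReal (r ^ (u - 1)) *
          ENNReal.ofReal (exp (-((1 + r) * s))) =
          ENNReal.ofReal (exp (-s)) * ENNReal.ofReal (Gamma u * s ^ (-u)) := by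
        rw [← lintegral_Ioi_rpow_mul_exp_neg hu hs,
          ← lintegral_const_mul' _ _ ENNReal.ofReal_ne_top]
        refine setLIntegral_congr_fun measurableSet_Ioi fun r (hr : 0 < r) => ?_
        rw [← ENNReal.ofReal_mul (by positivity), ← ENNReal.ofReal_mul (by positivity),
          show -((1 + r) * s) = -s + -(s * r) by ring, exp_add]
        ring_nf
      rw [hinner, ← ENNReal.ofReal_mul (by positivity), ← ENNReal.ofReal_mul (by positivity),
        ← ENNReal.ofReal_mul (Gamma_pos_of_pos hu).le,
        show v - 1 = (u + v - 1) + -u by ring, rpow_add hs, one_mul]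
      ring_nf
    _ = _ := by
      rw [lintegral_const_mul' _ _ ENNReal.ofReal_ne_top,
        lintegral_Ioi_rpow_mul_exp_neg hv one_pos, ← ENNReal.ofReal_mul (Gamma_pos_of_pos hu).le,
        one_rpow, mul_one]

theorem setLIntegral_Ioi_zero_eq_mul_comp_mul_left {t : ℝ} (ht : 0 < t) (g : ℝ → ℝ≥0∞) :
    ∫⁻ s in Ioi (0 : ℝ), g s = ENNReal.ofReal t * ∫⁻ r in Ioi (0 : ℝ), g (t * r) := by
  have h := lintegral_image_eq_lintegral_abs_deriv_mul (measurableSet_Ioi (a := (0 : ℝ)))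
    (fun r _ => ((hasDerivAt_id' r).const_mul t).hasDerivWithinAt)
    (mul_right_injective₀ ht.ne').injOn g
  rwa [image_const_mul_Ioi_zero ht, mul_one, abs_of_pos ht,
    lintegral_const_mul' _ _ ENNReal.ofReal_ne_top] at h

theorem ofReal_rpow_mul_lintegral_Ioi_add_rpow_neg_mul_exp_neg {a b c m t : ℝ} (ht : 0 < t) :
    ENNReal.ofReal (t ^ (a + c - 1)) *
        ∫⁻ s in Ioi (0 : ℝ), ENNReal.ofReal (s ^ (b + c - 1)) *
          ENNReal.ofReal ((s + t) ^ (-(a + b + c)) * exp (-(s * t / (s + t) * m))) =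
      ∫⁻ r in Ioi (0 : ℝ), ENNReal.ofReal (r ^ (b + c - 1) * (1 + r) ^ (-(a + b + c))) *
        ENNReal.ofReal (t ^ (c - 1) * exp (-(r * m / (1 + r) * t))) := by
  rw [setLIntegral_Ioi_zero_eq_mul_comp_mul_left ht, ← mul_assoc,
    ← ENNReal.ofReal_mul (by positivity), ← lintegral_const_mul' _ _ ENNReal.ofReal_ne_top]
  refine setLIntegral_congr_fun measurableSet_Ioi fun r (hr : 0 < r) => ?_
  have ht_pow : t ^ (a + c - 1) * t * t ^ (b + c - 1) * t ^ (-(a + b + c)) = t ^ (c - 1) := by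
    nth_rw 2 [← rpow_one t]
    simp only [← rpow_add ht]
    ring_nf
  have h_exponent : t * r * t / (t * r + t) * m = r * m / (1 + r) * t := by
    field_simp
    ring
  rw [← ENNReal.ofReal_mul (by positivity), ← ENNReal.ofReal_mul (by positivity),
    ← ENNReal.ofReal_mul (by positivity), ← ht_pow, h_exponent,
    show t * r + t = t * (1 + r) by ring, mul_rpow ht.le hr.le, mul_rpow ht.le (by positivity)]
  ring_nf

theorem lintegral_Ioi_lintegral_Ioi_rpow_mul_exp_neg {a b c m : ℝ} (ha : 0 < a) (hb : 0 < b)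
    (hc : 0 < c) (hm : 0 < m) :
    ∫⁻ t in Ioi (0 : ℝ), ENNReal.ofReal (t ^ (a + c - 1)) *
        ∫⁻ s in Ioi (0 : ℝ), ENNReal.ofReal (s ^ (b + c - 1)) *
          ENNReal.ofReal ((s + t) ^ (-(a + b + c)) * exp (-(s * t / (s + t) * m))) =
      ENNReal.ofReal (Gamma a * Gamma b * Gamma c / Gamma (a + b) * m ^ (-c)) := by
  calc
    _ = ∫⁻ t in Ioi (0 : ℝ), ∫⁻ r in Ioi (0 : ℝ),
        ENNReal.ofReal (r ^ (b + c - 1) * (1 + r) ^ (-(a + b + c))) *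
          ENNReal.ofReal (t ^ (c - 1) * exp (-(r * m / (1 + r) * t))) :=
      setLIntegral_congr_fun measurableSet_Ioi fun _ ht =>
        ofReal_rpow_mul_lintegral_Ioi_add_rpow_neg_mul_exp_neg ht
    _ = ∫⁻ r in Ioi (0 : ℝ), ∫⁻ t in Ioi (0 : ℝ),
        ENNReal.ofReal (r ^ (b + c - 1) * (1 + r) ^ (-(a + b + c))) *
          ENNReal.ofReal (t ^ (c - 1) * exp (-(r * m / (1 + r) * t))) :=
      lintegral_lintegral_swap (by fun_prop)
    _ = ∫⁻ r in Ioi (0 : ℝ), ENNReal.ofReal (Gamma c * m ^ (-c)) *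
        (ENNReal.ofReal (r ^ (b - 1)) * ENNReal.ofReal ((1 + r) ^ (-(b + a)))) := by
      refine setLIntegral_congr_fun measurableSet_Ioi fun r (hr : 0 < r) => ?_
      have h1r : 0 < 1 + r := by positivity
      rw [lintegral_const_mul' _ _ ENNReal.ofReal_ne_top,
        lintegral_Ioi_rpow_mul_exp_neg hc (by positivity), ← ENNReal.ofReal_mul (by positivity),
        ← ENNReal.ofReal_mul (by positivity), ← ENNReal.ofReal_mul (by positivity),
        div_rpow (by positivity) h1r.le, mul_rpow hr.le hm.le,
        show b - 1 = (b + c - 1) + -c by ring, rpow_add hr,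
        show -(b + a) = -(a + b + c) - -c by ring, rpow_sub h1r]
      ring_nf
    _ = _ := by
      rw [lintegral_const_mul' _ _ ENNReal.ofReal_ne_top,
        lintegral_Ioi_rpow_mul_one_add_rpow_neg hb ha, ← ENNReal.ofReal_mul (by positivity)]
      ring_nf

end Integrals

section Euclidean

open Real Set Module

variable {V : Type*} [NormedAddCommGroup V] [InnerProductSpace ℝ V]

theorem mul_norm_sub_sq_add_mul_norm_sq {s t : ℝ} (h : s + t ≠ 0) (x y : V) :
    s * ‖x - y‖ ^ 2 + t * ‖y‖ ^ 2 =
      (s + t) * ‖y - (s / (s + t)) • x‖ ^ 2 + s * t / (s + t) * ‖x‖ ^ 2 := by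
  rw [norm_sub_sq_real, norm_sub_sq_real, norm_smul, inner_smul_right, real_inner_comm y x,
    mul_pow, norm_eq_abs, sq_abs]
  field_simp
  ring

variable [FiniteDimensional ℝ V] [MeasurableSpace V] [BorelSpace V]

theorem lintegral_exp_neg_mul_norm_sq {b : ℝ} (hb : 0 < b) :
    ∫⁻ y : V, ENNReal.ofReal (exp (-(b * ‖y‖ ^ 2))) =
      ENNReal.ofReal ((π / b) ^ (finrank ℝ V / 2 : ℝ)) := by
  have h := GaussianFourier.integral_rexp_neg_mul_sq_norm (V := V) hb
  simp only [neg_mul] at h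
  rw [← h, ofReal_integral_eq_lintegral_ofReal _ (.of_forall fun y => (exp_pos _).le)]
  refine Integrable.of_integral_ne_zero ?_
  rw [h]
  positivity

theorem lintegral_exp_neg_mul_norm_sub_sq_mul_exp_neg_mul_norm_sq {s t : ℝ} (hs : 0 < s)
    (ht : 0 < t) (x : V) :
    ∫⁻ y : V, ENNReal.ofReal (exp (-(‖x - y‖ ^ 2 * s))) * ENNReal.ofReal (exp (-(‖y‖ ^ 2 * t))) =
      ENNReal.ofReal ((π / (s + t)) ^ (finrank ℝ V / 2 : ℝ) *
        exp (-(s * t / (s + t) * ‖x‖ ^ 2))) := by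
  have hst : 0 < s + t := by positivity
  calc
    _ = ∫⁻ y : V, ENNReal.ofReal (exp (-(s * t / (s + t) * ‖x‖ ^ 2))) *
        ENNReal.ofReal (exp (-((s + t) * ‖y - (s / (s + t)) • x‖ ^ 2))) := by
      refine lintegral_congr fun y => ?_
      rw [← ENNReal.ofReal_mul (exp_pos _).le, ← ENNReal.ofReal_mul (exp_pos _).le, ← exp_add,
        ← exp_add, ← neg_add, ← neg_add, mul_comm _ s, mul_comm _ t,
        mul_norm_sub_sq_add_mul_norm_sq hst.ne', add_comm (s * t / (s + t) * ‖x‖ ^ 2)]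
    _ = _ := by
      rw [lintegral_const_mul' _ _ ENNReal.ofReal_ne_top,
        lintegral_sub_right_eq_self
          (fun y : V => ENNReal.ofReal (exp (-((s + t) * ‖y‖ ^ 2)))),
        lintegral_exp_neg_mul_norm_sq hst, ← ENNReal.ofReal_mul (exp_pos _).le, mul_comm]

theorem lintegral_add_norm_sq_rpow_neg {m κ : ℝ} (hm : 0 < m) (hκ : (finrank ℝ V / 2 : ℝ) < κ) :
    ∫⁻ y : V, ENNReal.ofReal ((m + ‖y‖ ^ 2) ^ (-κ)) =
      ENNReal.ofReal (π ^ (finrank ℝ V / 2 : ℝ) * Gamma (κ - finrank ℝ V / 2) / Gamma κ *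
        m ^ (finrank ℝ V / 2 - κ : ℝ)) := by
  set d : ℝ := finrank ℝ V / 2 with hd
  have hκ_pos : 0 < κ := by
    have : 0 ≤ d := by positivity
    linarith
  have hΓ : 0 < Gamma κ := Gamma_pos_of_pos hκ_pos
  have hsub := ofReal_Gamma_mul_lintegral_mul_rpow_neg (μ := (volume : Measure V)) hκ_pos
    (g := 1) (F := fun y => m + ‖y‖ ^ 2) (by fun_prop) (by fun_prop)
    (.of_forall fun y => by positivity)
  simp only [Pi.one_apply, one_mul] at hsub
  rw [div_mul_eq_mul_div, ENNReal.ofReal_div_of_pos hΓ,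
    ENNReal.eq_div_iff (by simpa using hΓ) ENNReal.ofReal_ne_top, hsub]
  calc
    _ = ∫⁻ r in Ioi (0 : ℝ), ENNReal.ofReal (π ^ d) *
        ENNReal.ofReal (r ^ (κ - d - 1) * exp (-(m * r))) := by
      refine setLIntegral_congr_fun measurableSet_Ioi fun r (hr : 0 < r) => ?_
      have hsplit : ∀ y : V, ENNReal.ofReal (exp (-((m + ‖y‖ ^ 2) * r))) =
          ENNReal.ofReal (exp (-(m * r))) * ENNReal.ofReal (exp (-(r * ‖y‖ ^ 2))) := fun y => by
        rw [← ENNReal.ofReal_mul (exp_pos _).le, ← exp_add]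
        ring_nf
      simp only [hsplit]
      rw [lintegral_const_mul' _ _ ENNReal.ofReal_ne_top, lintegral_exp_neg_mul_norm_sq hr, ← hd,
        ← ENNReal.ofReal_mul (exp_pos _).le, ← ENNReal.ofReal_mul (by positivity),
        ← ENNReal.ofReal_mul (by positivity), div_rpow pi_pos.le hr.le,
        show κ - d - 1 = (κ - 1) - d by ring,
        rpow_sub hr (κ - 1) d]
      ring_nf
    _ = _ := by
      rw [lintegral_const_mul' _ _ ENNReal.ofReal_ne_top,
        lintegral_Ioi_rpow_mul_exp_neg (by linarith) hm, ← ENNReal.ofReal_mul (by positivity),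
        neg_sub, mul_assoc]

theorem sq_rpow_neg {x : ℝ} (hx : 0 ≤ x) (s : ℝ) : (x ^ 2) ^ (-s) = x ^ (-(2 * s)) := by
  rw [← rpow_natCast_mul hx, mul_neg, Nat.cast_ofNat]

/-- The constant in the composition formula for Riesz kernels, with the exponents parametrised
symmetrically: the kernels `‖x‖ ^ (-2 (b + c))` and `‖x‖ ^ (-2 (a + c))` on a space of real
dimension `2 (a + b + c)` convolve to this constant times `‖x‖ ^ (-2 c)`. -/
noncomputable def rieszConst (a b c : ℝ) : ℝ :=
  π ^ (a + b + c) *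
    (Gamma a * Gamma b * Gamma c / (Gamma (a + b) * Gamma (b + c) * Gamma (a + c)))

theorem rieszConst_pos {a b c : ℝ} (ha : 0 < a) (hb : 0 < b) (hc : 0 < c) :
    0 < rieszConst a b c := by
  unfold rieszConst
  positivity

theorem rieszConst_swap (a b c : ℝ) : rieszConst a c b = rieszConst a b c := by
  unfold rieszConst
  rw [add_right_comm a c b, add_comm c b]
  ring

theorem lintegral_norm_sub_rpow_mul_norm_rpow {a b c : ℝ} (ha : 0 < a) (hb : 0 < b) (hc : 0 < c)
    (hV : (finrank ℝ V : ℝ) = 2 * (a + b + c)) {x : V} (hx : x ≠ 0) :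
    ∫⁻ y : V, ENNReal.ofReal (‖x - y‖ ^ (-(2 * (b + c)))) *
        ENNReal.ofReal (‖y‖ ^ (-(2 * (a + c)))) =
      ENNReal.ofReal (rieszConst a b c) * ENNReal.ofReal (‖x‖ ^ (-(2 * c))) := by
  have : Nontrivial V := ⟨x, 0, hx⟩
  have hV' : (finrank ℝ V / 2 : ℝ) = a + b + c := by linarith
  have hsub_pos : ∀ᵐ y : V, 0 < ‖x - y‖ ^ 2 := by
    filter_upwards [(by simp [ae_iff] : ∀ᵐ y : V, y ≠ x)] with y hy
    have := sub_ne_zero.2 hy.symm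
    positivity
  have hpos : ∀ᵐ y : V, 0 < ‖y‖ ^ 2 := by
    filter_upwards [(by simp [ae_iff] : ∀ᵐ y : V, y ≠ 0)] with y hy
    positivity
  have hΓ : 0 < Gamma (b + c) * Gamma (a + c) := by positivity
  simp only [← sq_rpow_neg (norm_nonneg _)]
  rw [← ENNReal.mul_right_inj (a := ENNReal.ofReal (Gamma (b + c) * Gamma (a + c)))
    (by simpa using hΓ) ENNReal.ofReal_ne_top,
    ofReal_Gamma_mul_Gamma_mul_lintegral_rpow_neg_mul_rpow_neg (by positivity) (by positivity)
      (by fun_prop) (by fun_prop) hsub_pos hpos]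
  calc
    _ = ∫⁻ t in Ioi (0 : ℝ), ENNReal.ofReal (π ^ (a + b + c)) * (ENNReal.ofReal (t ^ (a + c - 1)) *
        ∫⁻ s in Ioi (0 : ℝ), ENNReal.ofReal (s ^ (b + c - 1)) * ENNReal.ofReal
          ((s + t) ^ (-(a + b + c)) * exp (-(s * t / (s + t) * ‖x‖ ^ 2)))) := by
      refine setLIntegral_congr_fun measurableSet_Ioi fun t (ht : 0 < t) => ?_
      rw [mul_left_comm]
      congr 1
      rw [← lintegral_const_mul' _ _ ENNReal.ofReal_ne_top]
      refine setLIntegral_congr_fun measurableSet_Ioi fun s (hs : 0 < s) => ?_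
      rw [lintegral_exp_neg_mul_norm_sub_sq_mul_exp_neg_mul_norm_sq hs ht, hV',
        div_rpow pi_pos.le (by positivity), rpow_neg (by positivity), mul_left_comm,
        ← ENNReal.ofReal_mul (p := π ^ (a + b + c)) (by positivity)]
      ring_nf
    _ = _ := by
      rw [lintegral_const_mul' _ _ ENNReal.ofReal_ne_top,
        lintegral_Ioi_lintegral_Ioi_rpow_mul_exp_neg ha hb hc (by positivity),
        ← ENNReal.ofReal_mul (by positivity), ← ENNReal.ofReal_mul (rieszConst_pos ha hb hc).le,
        ← ENNReal.ofReal_mul hΓ.le, rieszConst]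
      congr 1
      field_simp

end Euclidean

section Schur

variable {X Y : Type*} [MeasurableSpace X] [MeasurableSpace Y] {μ : Measure X} {ν : Measure Y}
  {p q : ℝ}

theorem rpow_lintegral_mul_le_mul_lintegral_weight (hpq : p.HolderConjugate q) {k g h : Y → ℝ≥0∞}
    (hk : AEMeasurable k ν) (hg : AEMeasurable g ν) (hh : AEMeasurable h ν)
    (hh_ne_zero : ∀ᵐ y ∂ν, h y ≠ 0) (hh_ne_top : ∀ᵐ y ∂ν, h y ≠ ∞) :
    (∫⁻ y, k y * g y ∂ν) ^ p ≤
      (∫⁻ y, k y * h y ^ q ∂ν) ^ (p / q) * ∫⁻ y, k y * ((h y)⁻¹ ^ p * g y ^ p) ∂ν := by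
  have hp := hpq.pos
  have hq := hpq.symm.pos
  have hsplit : ∫⁻ y, k y * g y ∂ν =
      ∫⁻ y, k y ^ (1 / q) * h y * (k y ^ (1 / p) * ((h y)⁻¹ * g y)) ∂ν := by
    refine lintegral_congr_ae ?_
    filter_upwards [hh_ne_zero, hh_ne_top] with y hy_zero hy_top
    calc
      _ = k y ^ (1 / q + 1 / p) * (h y * (h y)⁻¹) * g y := by
        rw [one_div, one_div, hpq.symm.inv_add_inv_eq_one, ENNReal.rpow_one,
          ENNReal.mul_inv_cancel hy_zero hy_top, mul_one]
      _ = _ := by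
        rw [ENNReal.rpow_add_of_nonneg _ _ (by positivity) (by positivity)]
        ring
  have hq_factor : ∀ y, (k y ^ (1 / q) * h y) ^ q = k y * h y ^ q := fun y => by
    rw [ENNReal.mul_rpow_of_nonneg _ _ hq.le, ← ENNReal.rpow_mul, one_div_mul_cancel hq.ne',
      ENNReal.rpow_one]
  have hp_factor : ∀ y, (k y ^ (1 / p) * ((h y)⁻¹ * g y)) ^ p = k y * ((h y)⁻¹ ^ p * g y ^ p) :=
    fun y => by
      rw [ENNReal.mul_rpow_of_nonneg _ _ hp.le, ← ENNReal.rpow_mul, one_div_mul_cancel hp.ne',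
        ENNReal.rpow_one, ENNReal.mul_rpow_of_nonneg _ _ hp.le]
  have hHolder := ENNReal.lintegral_mul_le_Lp_mul_Lq ν hpq.symm
    (f := fun y => k y ^ (1 / q) * h y) (g := fun y => k y ^ (1 / p) * ((h y)⁻¹ * g y))
    (by fun_prop) (by fun_prop)
  simp only [Pi.mul_apply, ← hsplit, hq_factor, hp_factor] at hHolder
  calc
    _ ≤ _ := ENNReal.rpow_le_rpow hHolder hp.le
    _ = _ := by
      rw [ENNReal.mul_rpow_of_nonneg _ _ hp.le, ← ENNReal.rpow_mul, ← ENNReal.rpow_mul,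
        one_div_mul_cancel hp.ne', ENNReal.rpow_one, one_div_mul_eq_div]

theorem rpow_lintegral_mul_le_of_lintegral_weight_le (hpq : p.HolderConjugate q)
    {k g h : Y → ℝ≥0∞} (hk : AEMeasurable k ν) (hg : AEMeasurable g ν) (hh : AEMeasurable h ν)
    (hh_ne_zero : ∀ᵐ y ∂ν, h y ≠ 0) (hh_ne_top : ∀ᵐ y ∂ν, h y ≠ ∞) {C m : ℝ≥0∞}
    (hm : ∫⁻ y, k y * h y ^ q ∂ν ≤ C * m ^ q) :
    (∫⁻ y, k y * g y ∂ν) ^ p ≤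
      C ^ (p / q) * ∫⁻ y, m ^ p * (k y * ((h y)⁻¹ ^ p * g y ^ p)) ∂ν := by
  have hp := hpq.pos
  have hq := hpq.symm.pos
  calc
    _ ≤ (C * m ^ q) ^ (p / q) * ∫⁻ y, k y * ((h y)⁻¹ ^ p * g y ^ p) ∂ν := by
      refine (rpow_lintegral_mul_le_mul_lintegral_weight hpq hk hg hh hh_ne_zero
        hh_ne_top).trans ?_
      gcongr
    _ = _ := by
      rw [lintegral_const_mul'' _ (by fun_prop), ENNReal.mul_rpow_of_nonneg _ _ (by positivity),
        ← ENNReal.rpow_mul, mul_div_cancel₀ _ hq.ne', mul_assoc]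

theorem lintegral_rpow_lintegral_mul_le_of_schur [SFinite μ] [SFinite ν]
    (hpq : p.HolderConjugate q) {K : X → Y → ℝ≥0∞} (hK : Measurable (Function.uncurry K))
    {h₁ : X → ℝ≥0∞} (hh₁ : Measurable h₁) {h₂ : Y → ℝ≥0∞} (hh₂ : Measurable h₂)
    (hh₂_ne_zero : ∀ᵐ y ∂ν, h₂ y ≠ 0) (hh₂_ne_top : ∀ᵐ y ∂ν, h₂ y ≠ ∞) {C : ℝ≥0∞}
    (hrow : ∀ᵐ x ∂μ, ∫⁻ y, K x y * h₂ y ^ q ∂ν ≤ C * h₁ x ^ q)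
    (hcol : ∀ᵐ y ∂ν, ∫⁻ x, K x y * h₁ x ^ p ∂μ ≤ C * h₂ y ^ p)
    {g : Y → ℝ≥0∞} (hg : AEMeasurable g ν) :
    ∫⁻ x, (∫⁻ y, K x y * g y ∂ν) ^ p ∂μ ≤ C ^ p * ∫⁻ y, g y ^ p ∂ν := by
  have hp := hpq.pos
  have hq := hpq.symm.pos
  have hKx : ∀ x, Measurable (K x) := fun x => hK.comp measurable_prodMk_left
  have hKy : ∀ y, Measurable fun x => K x y := fun y => hK.comp measurable_prodMk_right
  have hK' : Measurable fun a : X × Y => K a.1 a.2 := hK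
  have hexp : p / q + 1 = p := by
    have := hpq.inv_add_inv_eq_one
    field_simp at this ⊢
    linarith
  calc
    _ ≤ ∫⁻ x, C ^ (p / q) * ∫⁻ y, h₁ x ^ p * (K x y * ((h₂ y)⁻¹ ^ p * g y ^ p)) ∂ν ∂μ := by
      refine lintegral_mono_ae ?_
      filter_upwards [hrow] with x hx
      exact rpow_lintegral_mul_le_of_lintegral_weight_le hpq (hKx x).aemeasurable hg
        hh₂.aemeasurable hh₂_ne_zero hh₂_ne_top hx
    _ = C ^ (p / q) * ∫⁻ y, ∫⁻ x, h₁ x ^ p * (K x y * ((h₂ y)⁻¹ ^ p * g y ^ p)) ∂μ ∂ν := by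
      rw [lintegral_const_mul'' _ (by fun_prop), lintegral_lintegral_swap (by fun_prop)]
    _ ≤ C ^ (p / q) * ∫⁻ y, C * g y ^ p ∂ν := by
      refine mul_le_mul_right (lintegral_mono_ae ?_) _
      filter_upwards [hcol, hh₂_ne_zero, hh₂_ne_top] with y hy hy_zero hy_top
      calc
        _ = ((h₂ y)⁻¹ ^ p * g y ^ p) * ∫⁻ x, K x y * h₁ x ^ p ∂μ := by
          rw [← lintegral_const_mul _ (by fun_prop)]
          exact lintegral_congr fun x => by ring
        _ ≤ ((h₂ y)⁻¹ ^ p * g y ^ p) * (C * h₂ y ^ p) := by gcongr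
        _ = C * g y ^ p * (h₂ y * (h₂ y)⁻¹) ^ p := by
          rw [ENNReal.mul_rpow_of_nonneg _ _ hp.le]
          ring
        _ = _ := by rw [ENNReal.mul_inv_cancel hy_zero hy_top, ENNReal.one_rpow, mul_one]
    _ = _ := by
      rw [lintegral_const_mul'' _ (by fun_prop), ← mul_assoc]
      nth_rw 2 [← ENNReal.rpow_one C]
      rw [← ENNReal.rpow_add_of_nonneg _ _ (by positivity) zero_le_one, hexp]

theorem eLpNorm_lintegral_mul_le_of_schur [SFinite μ] [SFinite ν]
    (hpq : p.HolderConjugate q) {K : X → Y → ℝ≥0∞} (hK : Measurable (Function.uncurry K))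
    {h₁ : X → ℝ≥0∞} (hh₁ : Measurable h₁) {h₂ : Y → ℝ≥0∞} (hh₂ : Measurable h₂)
    (hh₂_ne_zero : ∀ᵐ y ∂ν, h₂ y ≠ 0) (hh₂_ne_top : ∀ᵐ y ∂ν, h₂ y ≠ ∞) {C : ℝ≥0∞}
    (hrow : ∀ᵐ x ∂μ, ∫⁻ y, K x y * h₂ y ^ q ∂ν ≤ C * h₁ x ^ q)
    (hcol : ∀ᵐ y ∂ν, ∫⁻ x, K x y * h₁ x ^ p ∂μ ≤ C * h₂ y ^ p)
    {g : Y → ℝ≥0∞} (hg : AEMeasurable g ν) :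
    eLpNorm (fun x => ∫⁻ y, K x y * g y ∂ν) (ENNReal.ofReal p) μ ≤
      C * eLpNorm g (ENNReal.ofReal p) ν := by
  have hp := hpq.pos
  simp only [eLpNorm_eq_lintegral_rpow_enorm_toReal (ENNReal.ofReal_pos.2 hp).ne'
    ENNReal.ofReal_ne_top, ENNReal.toReal_ofReal hp.le, enorm_eq_self]
  calc
    _ ≤ (C ^ p * ∫⁻ y, g y ^ p ∂ν) ^ (1 / p) := by
      gcongr
      exact lintegral_rpow_lintegral_mul_le_of_schur hpq hK hh₁ hh₂ hh₂_ne_zero hh₂_ne_top hrow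
        hcol hg
    _ = _ := by
      rw [ENNReal.mul_rpow_of_nonneg _ _ (by positivity), ← ENNReal.rpow_mul,
        mul_one_div_cancel hp.ne', ENNReal.rpow_one]

end Schur

theorem mlconvolution_apply_eq_lintegral_mul_inv {G : Type*} [Group G] [MeasurableSpace G]
    [MeasurableMul G] [MeasurableInv G] {μ : Measure G} [μ.IsMulLeftInvariant] [μ.IsInvInvariant]
    (f g : G → ℝ≥0∞) (x : G) :
    (f ⋆ₘₗ[μ] g) x = ∫⁻ y, f (x * y⁻¹) * g y ∂μ := by
  rw [mlconvolution_def, ← lintegral_mul_left_eq_self _ x, ← lintegral_inv_eq_self]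
  simp

theorem ae_lt_top_of_eLpNorm_lt_top {X : Type*} [MeasurableSpace X] {μ : Measure X} {p : ℝ≥0∞}
    {g : X → ℝ≥0∞} (hg : AEMeasurable g μ) (hp : p ≠ 0) (h : eLpNorm g p μ < ∞) :
    ∀ᵐ x ∂μ, g x < ∞ := by
  rcases eq_or_ne p ∞ with rfl | hp_top
  · rw [eLpNorm_exponent_top] at h
    filter_upwards [enorm_ae_le_eLpNormEssSup g μ] with x hx using hx.trans_lt h
  · have hint := lintegral_rpow_enorm_lt_top_of_eLpNorm_lt_top hp hp_top h
    filter_upwards [ae_lt_top' (hg.enorm.pow_const _) hint.ne] with x hx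
    exact (ENNReal.rpow_lt_top_iff_of_pos (ENNReal.toReal_pos hp hp_top)).1 hx

theorem ofReal_div_le_ofReal {x y : ℝ} (hy : 1 ≤ y) :
    ENNReal.ofReal (x / y) ≤ ENNReal.ofReal x := by
  rw [ENNReal.ofReal_div_of_pos (one_pos.trans_le hy)]
  exact ENNReal.div_le_of_le_mul (le_mul_of_one_le_right' (ENNReal.one_le_ofReal.2 hy))

namespace Heisenberg

open Real

variable {n : ℕ}

@[simp] theorem mk_z (z : EuclideanSpace ℂ (Fin n)) (t : ℝ) : (mk z t).z = z := rfl

@[simp] theorem mk_t (z : EuclideanSpace ℂ (Fin n)) (t : ℝ) : (mk z t).t = t := rfl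

@[fun_prop]
theorem measurable_z : Measurable (z : Heisenberg n → EuclideanSpace ℂ (Fin n)) := measurable_fst

@[fun_prop]
theorem measurable_t : Measurable (t : Heisenberg n → ℝ) := measurable_snd

theorem measurable_mk_comp {X : Type*} [MeasurableSpace X] {f : X → EuclideanSpace ℂ (Fin n)}
    {g : X → ℝ} (hf : Measurable f) (hg : Measurable g) :
    Measurable fun x => (mk (f x) (g x) : Heisenberg n) := hf.prodMk hg

instance : MeasurableInv (Heisenberg n) where
  measurable_inv := measurable_mk_comp measurable_z.neg measurable_t.neg

instance : MeasurableMul₂ (Heisenberg n) where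
  measurable_mul := by
    refine measurable_mk_comp (f := fun x : Heisenberg n × Heisenberg n => x.1.z + x.2.z)
      (g := fun x => x.1.t + x.2.t + 2 * (∑ k, x.1.z k * starRingEnd ℂ (x.2.z k)).im)
      (by fun_prop) ?_
    have hconj : Measurable (starRingEnd ℂ) := Complex.continuous_conj.measurable
    fun_prop

instance : SFinite (haar n) :=
  inferInstanceAs (SFinite ((4 : ℝ≥0∞) ^ n •
    (volume : Measure (EuclideanSpace ℂ (Fin n) × ℝ))))

instance : (haar n).IsMulLeftInvariant where
  map_mul_left_eq_self g := by
    refine (MeasurePreserving.smul_measure ?_ _).map_eq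
    refine MeasurePreserving.skew_product
      (f := fun z : EuclideanSpace ℂ (Fin n) => g.z + z)
      (g := fun z t => g.t + t + 2 * (∑ k, g.z k * starRingEnd ℂ (z k)).im)
      (measurePreserving_add_left volume g.z) (measurable_t.comp (measurable_const_mul g))
      (.of_forall fun z => ?_)
    simpa only [add_right_comm] using
      map_add_left_eq_self volume (g.t + 2 * (∑ k, g.z k * starRingEnd ℂ (z k)).im)

instance : (haar n).IsInvInvariant where
  inv_eq_self := (((Measure.measurePreserving_neg volume).prod
    (Measure.measurePreserving_neg volume)).smul_measure _).map_eq

theorem lintegral_haar {F : Heisenberg n → ℝ≥0∞} (hF : Measurable F) :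
    ∫⁻ w, F w ∂(haar n) = 4 ^ n * ∫⁻ z, ∫⁻ t : ℝ, F (mk z t) := by
  have hF' : Measurable fun x : EuclideanSpace ℂ (Fin n) × ℝ => F (mk x.1 x.2) := hF
  calc
    _ = ∫⁻ x : EuclideanSpace ℂ (Fin n) × ℝ, F (mk x.1 x.2) ∂((4 : ℝ≥0∞) ^ n • volume) := rfl
    _ = _ := by
      rw [lintegral_smul_measure, Measure.volume_eq_prod, smul_eq_mul,
        lintegral_prod _ hF'.aemeasurable]

theorem ae_z_ne_zero (hn : n ≠ 0) : ∀ᵐ w ∂(haar n), w.z ≠ 0 := by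
  have : NeZero n := ⟨hn⟩
  have h : ∀ᵐ z : EuclideanSpace ℂ (Fin n), z ≠ 0 := by simp [ae_iff]
  exact Measure.ae_smul_measure (Measure.quasiMeasurePreserving_fst.ae h) _

@[fun_prop]
theorem measurable_kernel (lam : ℝ) : Measurable (kernel n lam) := by
  unfold kernel gauge
  fun_prop

theorem kernel_nonneg (lam : ℝ) (w : Heisenberg n) : 0 ≤ kernel n lam w := by
  unfold kernel gauge
  positivity

theorem kernel_inv (lam : ℝ) (w : Heisenberg n) : kernel n lam w⁻¹ = kernel n lam w := by
  simp [kernel, gauge]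

theorem kernel_eq (lam : ℝ) (w : Heisenberg n) :
    kernel n lam w = (‖w.z‖ ^ 4 + w.t ^ 2) ^ (-(lam / 4)) := by
  rw [kernel, gauge, ← rpow_mul (by positivity)]
  ring_nf

theorem lintegral_kernel_mul_inv_mk {s : ℝ} (hs : 0 < s) (w : Heisenberg n)
    {z' : EuclideanSpace ℂ (Fin n)} (hz : w.z ≠ z') :
    ∫⁻ t', ENNReal.ofReal (kernel n (2 * s + 2) (w * (mk z' t')⁻¹)) =
      ENNReal.ofReal (√π * Gamma (s / 2) / Gamma ((s + 1) / 2)) *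
        ENNReal.ofReal (‖w.z - z'‖ ^ (-(2 * s))) := by
  have hz_pos : 0 < ‖w.z - z'‖ := norm_pos_iff.2 (sub_ne_zero.2 hz)
  set τ := w.t + 2 * (∑ k, w.z k * starRingEnd ℂ ((-z') k)).im
  have hkernel : ∀ t', kernel n (2 * s + 2) (w * (mk z' t')⁻¹) =
      (‖w.z - z'‖ ^ 4 + ‖τ - t'‖ ^ 2) ^ (-((s + 1) / 2)) := fun t' => by
    rw [kernel_eq, mul_z, mul_t, inv_z, inv_t, mk_z, mk_t, ← sub_eq_add_neg, norm_eq_abs, sq_abs,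
      show (2 * s + 2) / 4 = (s + 1) / 2 by ring, add_right_comm, ← sub_eq_add_neg]
  simp only [hkernel]
  rw [lintegral_sub_left_eq_self
      (fun t' : ℝ => ENNReal.ofReal ((‖w.z - z'‖ ^ 4 + ‖t'‖ ^ 2) ^ (-((s + 1) / 2)))) τ,
    lintegral_add_norm_sq_rpow_neg (by positivity) (by rw [Module.finrank_self]; linarith),
    Module.finrank_self, Nat.cast_one, ← sqrt_eq_rpow, ← rpow_natCast_mul hz_pos.le,
    show (s + 1) / 2 - 1 / 2 = s / 2 by ring, ENNReal.ofReal_mul (by positivity)]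
  push_cast
  ring_nf

/-- The constant in the Schur test for the Stein–Weiss kernel on `ℍₙ`. The factors come from the
normalisation of `haar n`, the integral of the kernel over a coset of the centre, and the
composition of Riesz kernels on `ℂⁿ`. -/
noncomputable def schurConst (n : ℕ) (a b c : ℝ) : ℝ :=
  4 ^ n * (√π * Gamma ((b + c) / 2) / Gamma ((b + c + 1) / 2)) * rieszConst a b c

theorem schurConst_swap (n : ℕ) (a b c : ℝ) : schurConst n a c b = schurConst n a b c := by
  rw [schurConst, schurConst, rieszConst_swap, add_comm c b]

theorem steinWeissConst_eq {p q : ℝ} (hpq : 1 / p + 1 / q = 1) (α β : ℝ) :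
    steinWeissConst n p q α β =
      π ^ n * schurConst n ((α + β) / 2) (n / q - β / 2) (n / p - α / 2) := by
  have hn : n / p + n / q = (n : ℝ) := by linear_combination (n : ℝ) * hpq
  have hab : (α + β) / 2 + (n / q - β / 2) = n / q + α / 2 := by ring
  have hac : (α + β) / 2 + (n / p - α / 2) = n / p + β / 2 := by ring
  have hbc : n / q - β / 2 + (n / p - α / 2) = (2 * n - α - β) / 2 := by
    linear_combination hn
  have habc : n / q + α / 2 + (n / p - α / 2) = n := by linear_combination hn
  unfold steinWeissConst schurConst rieszConst
  rw [hab, hac, hbc, habc, rpow_natCast, mul_pow, ← pow_mul, pow_mul']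
  ring_nf

theorem lintegral_kernel_mul_norm_rpow {a b c : ℝ} (ha : 0 < a) (hb : 0 < b) (hc : 0 < c)
    (habc : a + b + c = n) {w : Heisenberg n} (hw : w.z ≠ 0) :
    ∫⁻ u, ENNReal.ofReal (kernel n (2 * (b + c) + 2) (w * u⁻¹)) *
        ENNReal.ofReal (‖u.z‖ ^ (-(2 * (a + c)))) ∂(haar n) =
      ENNReal.ofReal (schurConst n a b c) * ENNReal.ofReal (‖w.z‖ ^ (-(2 * c))) := by
  have : Nontrivial (EuclideanSpace ℂ (Fin n)) := ⟨w.z, 0, hw⟩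
  have hrank : (Module.finrank ℝ (EuclideanSpace ℂ (Fin n)) : ℝ) = 2 * (a + b + c) := by
    simp [finrank_real_of_complex, habc]
  rw [lintegral_haar (by fun_prop)]
  calc
    _ = 4 ^ n * ∫⁻ z', ENNReal.ofReal (√π * Gamma ((b + c) / 2) / Gamma ((b + c + 1) / 2)) *
          (ENNReal.ofReal (‖w.z - z'‖ ^ (-(2 * (b + c)))) *
          ENNReal.ofReal (‖z'‖ ^ (-(2 * (a + c))))) := by
      congr 1
      refine lintegral_congr_ae ?_
      filter_upwards [(by simp [ae_iff] : ∀ᵐ z', z' ≠ w.z)] with z' hz'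
      rw [← mul_assoc, ← lintegral_kernel_mul_inv_mk (by positivity) w hz'.symm]
      exact lintegral_mul_const' (ENNReal.ofReal (‖z'‖ ^ (-(2 * (a + c))))) _ ENNReal.ofReal_ne_top
    _ = _ := by
      rw [lintegral_const_mul' _ _ ENNReal.ofReal_ne_top,
        lintegral_norm_sub_rpow_mul_norm_rpow ha hb hc hrank hw, schurConst,
        ENNReal.ofReal_mul (by positivity), ENNReal.ofReal_mul (by positivity),
        ENNReal.ofReal_pow (by positivity), ENNReal.ofReal_ofNat, mul_assoc, mul_assoc]

/-- The integral kernel, with respect to `haar n`, of the Stein–Weiss operator, written in the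
variable `u = v⁻¹ w` of `f` and with values in `[0, ∞]`. -/
noncomputable def steinWeissKernel (lam α β : ℝ) (w u : Heisenberg n) : ℝ≥0∞ :=
  ENNReal.ofReal (‖w.z‖ ^ (-α)) * ENNReal.ofReal (kernel n lam (w * u⁻¹)) *
    ENNReal.ofReal (‖u.z‖ ^ (-β))

theorem measurable_uncurry_steinWeissKernel (lam α β : ℝ) :
    Measurable (Function.uncurry (steinWeissKernel (n := n) lam α β)) := by
  unfold steinWeissKernel
  fun_prop

theorem steinWeissKernel_symm (lam α β : ℝ) (w u : Heisenberg n) :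
    steinWeissKernel lam α β w u = steinWeissKernel lam β α u w := by
  rw [steinWeissKernel, steinWeissKernel, ← kernel_inv _ (w * u⁻¹), mul_inv_rev, inv_inv]
  ring

theorem lintegral_steinWeissKernel_mul_norm_rpow {a b c α β γ δ : ℝ} (ha : 0 < a) (hb : 0 < b)
    (hc : 0 < c) (habc : a + b + c = n) (hγ : β + γ = 2 * (a + c))
    (hδ : δ = α + 2 * c) {w : Heisenberg n} (hw : w.z ≠ 0) :
    ∫⁻ u, steinWeissKernel (2 * (b + c) + 2) α β w u * ENNReal.ofReal (‖u.z‖ ^ (-γ)) ∂(haar n) =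
      ENNReal.ofReal (schurConst n a b c) * ENNReal.ofReal (‖w.z‖ ^ (-δ)) := by
  have hn : n ≠ 0 := by
    rw [← Nat.cast_ne_zero (R := ℝ), ← habc]
    positivity
  have hw' : 0 < ‖w.z‖ := norm_pos_iff.2 hw
  calc
    _ = ∫⁻ u, ENNReal.ofReal (‖w.z‖ ^ (-α)) *
        (ENNReal.ofReal (kernel n (2 * (b + c) + 2) (w * u⁻¹)) *
          ENNReal.ofReal (‖u.z‖ ^ (-(2 * (a + c))))) ∂(haar n) := by
      refine lintegral_congr_ae ?_
      filter_upwards [ae_z_ne_zero hn] with u hu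
      have hu' : 0 < ‖u.z‖ := norm_pos_iff.2 hu
      rw [steinWeissKernel, ← hγ, neg_add, rpow_add hu', ENNReal.ofReal_mul (by positivity)]
      ring
    _ = _ := by
      rw [lintegral_const_mul' _ _ ENNReal.ofReal_ne_top,
        lintegral_kernel_mul_norm_rpow ha hb hc habc hw, hδ, neg_add, rpow_add hw',
        ENNReal.ofReal_mul (by positivity), mul_left_comm]

theorem eLpNorm_lintegral_steinWeissKernel_mul_le {p q a b c α β : ℝ} (hpq : p.HolderConjugate q)
    (ha : 0 < a) (hb : 0 < b) (hc : 0 < c) (habc : a + b + c = n)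
    (hα : 2 * n / p = α + 2 * c) (hβ : 2 * n / q = β + 2 * b) (hab : 2 * a = α + β)
    {g : Heisenberg n → ℝ≥0∞} (hg : AEMeasurable g (haar n)) :
    eLpNorm (fun w => ∫⁻ u, steinWeissKernel (2 * (b + c) + 2) α β w u * g u ∂(haar n))
        (ENNReal.ofReal p) (haar n) ≤
      ENNReal.ofReal (schurConst n a b c) * eLpNorm g (ENNReal.ofReal p) (haar n) := by
  have hp := hpq.pos
  have hq := hpq.symm.pos
  have hn : n ≠ 0 := by
    rw [← Nat.cast_ne_zero (R := ℝ), ← habc]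
    positivity
  let h : Heisenberg n → ℝ≥0∞ := fun w => ENNReal.ofReal (‖w.z‖ ^ (-(2 * n / (p * q))))
  have h_meas : Measurable h := by fun_prop
  have h_ne_zero : ∀ᵐ w ∂(haar n), h w ≠ 0 := by
    filter_upwards [ae_z_ne_zero hn] with w hw
    have : 0 < ‖w.z‖ := norm_pos_iff.2 hw
    exact (ENNReal.ofReal_pos.2 (by positivity)).ne'
  have h_rpow : ∀ (s : ℝ), 0 < s → ∀ w, h w ^ s =
      ENNReal.ofReal (‖w.z‖ ^ (-(2 * n / (p * q) * s))) := fun s hs w => by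
    rw [ENNReal.ofReal_rpow_of_nonneg (by positivity) hs.le, ← rpow_mul (norm_nonneg _), neg_mul]
  refine eLpNorm_lintegral_mul_le_of_schur hpq (measurable_uncurry_steinWeissKernel _ _ _)
    h_meas h_meas h_ne_zero (.of_forall fun w => ENNReal.ofReal_ne_top) ?_ ?_ hg
  · filter_upwards [ae_z_ne_zero hn] with w hw
    simp only [h_rpow q hq, show 2 * n / (p * q) * q = 2 * n / p by field_simp]
    exact (lintegral_steinWeissKernel_mul_norm_rpow ha hb hc habc (by linarith) hα hw).le
  · filter_upwards [ae_z_ne_zero hn] with u hu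
    simp only [h_rpow p hp, show 2 * n / (p * q) * p = 2 * n / q by field_simp]
    simp only [steinWeissKernel_symm _ α β]
    rw [add_comm b c, ← schurConst_swap]
    exact (lintegral_steinWeissKernel_mul_norm_rpow ha hc hb (by linarith) (by linarith) hβ
      hu).le

theorem enorm_weighted (β : ℝ) (f : Heisenberg n → ℂ) (w : Heisenberg n) :
    ‖weighted β f w‖ₑ = ENNReal.ofReal (‖w.z‖ ^ (-β)) * ‖f w‖ₑ := by
  rw [weighted, enorm_smul, Real.enorm_of_nonneg (by positivity)]

theorem lintegral_steinWeissKernel_mul_enorm (lam α β : ℝ) (f : Heisenberg n → ℂ)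
    (w : Heisenberg n) :
    ∫⁻ u, steinWeissKernel lam α β w u * ‖f u‖ₑ ∂(haar n) =
      ENNReal.ofReal (‖w.z‖ ^ (-α)) *
        ∫⁻ v, ‖kernel n lam v • weighted β f (v⁻¹ * w)‖ₑ ∂(haar n) := by
  have hconv : ∫⁻ v, ‖kernel n lam v • weighted β f (v⁻¹ * w)‖ₑ ∂(haar n) =
      ((fun v => ENNReal.ofReal (kernel n lam v)) ⋆ₘₗ[haar n] fun u => ‖weighted β f u‖ₑ) w := by
    simp only [mlconvolution_def, enorm_smul, Real.enorm_of_nonneg (kernel_nonneg _ _)]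
  rw [hconv, mlconvolution_apply_eq_lintegral_mul_inv,
    ← lintegral_const_mul' _ _ ENNReal.ofReal_ne_top]
  refine lintegral_congr fun u => ?_
  rw [steinWeissKernel, enorm_weighted, mul_assoc, mul_assoc]

theorem enorm_steinWeiss_le (lam α β : ℝ) (f : Heisenberg n → ℂ) (w : Heisenberg n) :
    ‖steinWeiss lam α β f w‖ₑ ≤ ∫⁻ u, steinWeissKernel lam α β w u * ‖f u‖ₑ ∂(haar n) := by
  rw [lintegral_steinWeissKernel_mul_enorm, steinWeiss, enorm_weighted]
  gcongr
  exact enorm_integral_le_lintegral_enorm _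

theorem aestronglyMeasurable_weighted (β : ℝ) {f : Heisenberg n → ℂ}
    (hf : AEStronglyMeasurable f (haar n)) : AEStronglyMeasurable (weighted β f) (haar n) :=
  
  (measurable_z.norm.pow_const (-β)).aestronglyMeasurable.smul hf

theorem aestronglyMeasurable_kernel_smul (lam : ℝ) {g : Heisenberg n → ℂ}
    (hg : AEStronglyMeasurable g (haar n)) (w : Heisenberg n) :
    AEStronglyMeasurable (fun v => kernel n lam v • g (v⁻¹ * w)) (haar n) := by
  have hmp := (Measure.measurePreserving_mul_right_inv (haar n) w⁻¹).quasiMeasurePreserving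
  simp only [mul_inv_rev, inv_inv] at hmp
  exact (measurable_kernel lam).aestronglyMeasurable.smul (hg.comp_quasiMeasurePreserving hmp)

theorem aestronglyMeasurable_conv_kernel (lam : ℝ) {g : Heisenberg n → ℂ}
    (hg : AEStronglyMeasurable g (haar n)) :
    AEStronglyMeasurable (conv (kernel n lam) g) (haar n) := by
  refine AEStronglyMeasurable.integral_prod_right'
    (f := fun x : Heisenberg n × Heisenberg n => kernel n lam x.2 • g (x.2⁻¹ * x.1)) ?_
  exact ((measurable_kernel lam).comp measurable_snd).aestronglyMeasurable.smul
    (hg.comp_quasiMeasurePreserving (quasiMeasurePreserving_inv_mul_swap _ _))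

theorem convExistsAt_of_lintegral_steinWeissKernel_lt_top {lam α β : ℝ} {f : Heisenberg n → ℂ}
    (hf : AEStronglyMeasurable f (haar n)) {w : Heisenberg n} (hw : w.z ≠ 0)
    (h : ∫⁻ u, steinWeissKernel lam α β w u * ‖f u‖ₑ ∂(haar n) < ∞) :
    ConvExistsAt (kernel n lam) (weighted β f) w := by
  have hw' : 0 < ‖w.z‖ := norm_pos_iff.2 hw
  rw [lintegral_steinWeissKernel_mul_enorm] at h
  exact ⟨aestronglyMeasurable_kernel_smul lam (aestronglyMeasurable_weighted β hf) w,
    ENNReal.lt_top_of_mul_ne_top_right h.ne (ENNReal.ofReal_pos.2 (by positivity)).ne'⟩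

theorem memLp_steinWeiss_of_eLpNorm_lintegral_steinWeissKernel_le (hn : n ≠ 0) {lam α β : ℝ}
    {p C : ℝ≥0∞} (hp : p ≠ 0) (hC : C ≠ ∞) {f : Heisenberg n → ℂ} (hf : MemLp f p (haar n))
    (h : eLpNorm (fun w => ∫⁻ u, steinWeissKernel lam α β w u * ‖f u‖ₑ ∂(haar n)) p (haar n) ≤
      C * eLpNorm f p (haar n)) :
    (∀ᵐ w ∂(haar n), ConvExistsAt (kernel n lam) (weighted β f) w) ∧
    MemLp (steinWeiss lam α β f) p (haar n) ∧
    eLpNorm (steinWeiss lam α β f) p (haar n) ≤ C * eLpNorm f p (haar n) := by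
  have hC_lt_top : C * eLpNorm f p (haar n) < ∞ := ENNReal.mul_lt_top hC.lt_top hf.2
  have hmeas : AEMeasurable
      (fun w => ∫⁻ u, steinWeissKernel lam α β w u * ‖f u‖ₑ ∂(haar n)) (haar n) :=
    AEMeasurable.lintegral_prod_right
      ((measurable_uncurry_steinWeissKernel lam α β).aemeasurable.mul hf.1.enorm.comp_snd)
  have hle : eLpNorm (steinWeiss lam α β f) p (haar n) ≤ C * eLpNorm f p (haar n) :=
    (eLpNorm_mono_enorm fun w => enorm_steinWeiss_le lam α β f w).trans h
  refine ⟨?_, ⟨?_, hle.trans_lt hC_lt_top⟩, hle⟩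
  · filter_upwards [ae_z_ne_zero hn, ae_lt_top_of_eLpNorm_lt_top hmeas hp (h.trans_lt hC_lt_top)]
      with w hw hw_lt_top
    exact convExistsAt_of_lintegral_steinWeissKernel_lt_top hf.1 hw hw_lt_top
  · exact aestronglyMeasurable_weighted α
      (aestronglyMeasurable_conv_kernel lam (aestronglyMeasurable_weighted β hf.1))

end Heisenberg

theorem theorem9_general (n : ℕ) (p q lam α β : ℝ) (hp : 1 < p) (hpq : 1 / p + 1 / q = 1)
    (hlam' : lam < 2 * n + 2) (hα : α < 2 * n / p) (hβ : β < 2 * n / q)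
    (hsum : 2 * (n : ℝ) + 2 = lam + α + β)
    (f : Heisenberg n → ℂ) (hf : MemLp f (ENNReal.ofReal p) (Heisenberg.haar n)) :
    (∀ᵐ w ∂(Heisenberg.haar n),
      Heisenberg.ConvExistsAt (Heisenberg.kernel n lam) (Heisenberg.weighted β f) w) ∧
    MemLp (Heisenberg.steinWeiss lam α β f) (ENNReal.ofReal p) (Heisenberg.haar n) ∧
    eLpNorm (Heisenberg.steinWeiss lam α β f) (ENNReal.ofReal p) (Heisenberg.haar n) ≤
      ENNReal.ofReal (Heisenberg.steinWeissConst n p q α β / Real.pi ^ n) *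
        eLpNorm f (ENNReal.ofReal p) (Heisenberg.haar n) := by
  have hconj : p.HolderConjugate q := Real.holderConjugate_iff.2 ⟨hp, by simpa using hpq⟩
  obtain ⟨a, ha⟩ : ∃ a, a = (α + β) / 2 := ⟨_, rfl⟩
  obtain ⟨b, hb⟩ : ∃ b, b = n / q - β / 2 := ⟨_, rfl⟩
  obtain ⟨c, hc⟩ : ∃ c, c = n / p - α / 2 := ⟨_, rfl⟩
  have habc : a + b + c = n := by linear_combination ha + hb + hc + (n : ℝ) * hpq
  obtain rfl : lam = 2 * (b + c) + 2 := by linear_combination -hsum - 2 * habc + 2 * ha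
  have ha_pos : 0 < a := by linarith
  have hb_pos : 0 < b := by linarith [mul_div_assoc (2 : ℝ) n q]
  have hc_pos : 0 < c := by linarith [mul_div_assoc (2 : ℝ) n p]
  have hn : n ≠ 0 := by
    rw [← Nat.cast_ne_zero (R := ℝ), ← habc]
    positivity
  rw [Heisenberg.steinWeissConst_eq hpq, ← ha, ← hb, ← hc,
    mul_div_cancel_left₀ _ (pow_ne_zero n Real.pi_ne_zero)]
  refine Heisenberg.memLp_steinWeiss_of_eLpNorm_lintegral_steinWeissKernel_le hn
    (ENNReal.ofReal_pos.2 hconj.pos).ne' ENNReal.ofReal_ne_top hf ?_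
  rw [← eLpNorm_enorm f]
  exact Heisenberg.eLpNorm_lintegral_steinWeissKernel_mul_le hconj ha_pos hb_pos hc_pos habc
    (by rw [hc]; ring) (by rw [hb]; ring) (by rw [ha]; ring) hf.1.enorm

theorem theorem9 (n : ℕ) (p q lam α β : ℝ) (hp : 1 < p) (hpq : 1 / p + 1 / q = 1)
    (hlam : 0 < lam) (hlam' : lam < 2 * n + 2) (hα : α < 2 * n / p) (hβ : β < 2 * n / q)
    (hsum : 2 * (n : ℝ) + 2 = lam + α + β)
    (f : Heisenberg n → ℂ) (hf : MemLp f (ENNReal.ofReal p) (Heisenberg.haar n)) :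
    (∀ᵐ w ∂(Heisenberg.haar n),
      Heisenberg.ConvExistsAt (Heisenberg.kernel n lam) (Heisenberg.weighted β f) w) ∧
    MemLp (Heisenberg.steinWeiss lam α β f) (ENNReal.ofReal p) (Heisenberg.haar n) ∧
    eLpNorm (Heisenberg.steinWeiss lam α β f) (ENNReal.ofReal p) (Heisenberg.haar n) ≤
      ENNReal.ofReal (Heisenberg.steinWeissConst n p q α β) *
        eLpNorm f (ENNReal.ofReal p) (Heisenberg.haar n) := by
  obtain ⟨hexists, hmem, hle⟩ := theorem9_general n p q lam α β hp hpq hlam' hα hβ hsum f hf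
  have hpi : 1 ≤ Real.pi ^ n := one_le_pow₀ (by linarith [Real.pi_gt_three])
  exact ⟨hexists, hmem, hle.trans (mul_le_mul_left (ofReal_div_le_ofReal hpi) _)⟩
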